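/- A closed lambda-term (up to renaming of bound variables) is regarded as an enriched tree: a plane unary-binary tree whose unary nodes are the abstractions, whose binary nodes are the applications and whose leaves are the variable occurrences, where each leaf is bound by (receives a pointer from) exactly one unary node among its ancestors. The size of a term is its total number of nodes: $|x|=1$, $|\lambda x.T|=1+|T|$, $|(S*T)|=1+|S|+|T|$. For an integer $p\ge 0$, a $BCK(p)$-term is a closed lambda-term in which each unary node binds at most $p$ leaves. Let $f_n$ be the number of $BCK(p)$-terms of size $n$ and let $F_p(z)=\sum_{n\ge 1} f_n z^n$ be their generating function, a formal power series. Let $C_m=\frac1{m+1}\binom{2m}{m}$ denote the Catalan numbers, let $D$ be the formal derivative with respect to $z$, and for $k\ge 1$ put $$\Delta_k=\sum_{l=1}^{k}\frac{\alpha_{l,k}}{l!}\,z^{l+2k+1}D^l,\qquad \alpha_{l,k}=\sum_{\substack{s_1,\dots,s_k\ge 0\\ \sum_i s_i=l,\ \sum_i i s_i=k}}\binom{l}{s_1,\dots,s_k}\prod_{m=1}^{k}\binom{2m}{m}^{s_m}.$$ Then there is exactly one formal power series $Y(z)=\sum_{n\ge 0}Y_nz^n$ with nonnegative real coefficients which satisfies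 $$Y(z)=\sum_{l=1}^{p}C_{l-1}z^{2l}+z\,Y(z)^2+\Big(\sum_{l=1}^{p}\Delta_l\Big)Y(z),$$ and for this $Y$ $$F_p(z)=Y\!\left(\frac{z}{1-z}\right).$$ -/

import Mathlib

/-- A lambda-term up to renaming of bound variables, i.e. an enriched tree: a plane unary-binary
tree (`var` = leaf, `abs` = unary node, `app` = binary node) together with a pointer to each leaf.
The leaf `var k` receives its pointer from the unary node met after skipping `k` unary nodes on the
way from the leaf up to the root; it is free if there is no such unary node. -/
inductive LambdaTerm : Type
  | var (k : ℕ) : LambdaTerm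
  | abs (t : LambdaTerm) : LambdaTerm
  | app (s t : LambdaTerm) : LambdaTerm

namespace LambdaTerm

/-- `|x| = 1`, `|λ x. T| = 1 + |T|`, `|S * T| = 1 + |S| + |T|`. -/
def size : LambdaTerm → ℕ
  | var _ => 1
  | abs t => 1 + t.size
  | app s t => 1 + s.size + t.size

/-- All leaves of the term are bound once the term is placed below `d` unary nodes. -/
def ClosedUnder : ℕ → LambdaTerm → Prop
  | d, var k => k < d
  | d, abs t => ClosedUnder (d + 1) t
  | d, app s t => ClosedUnder d s ∧ ClosedUnder d t

/-- A closed lambda-term: each leaf is bound by a unary node of the term. -/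
def IsClosed (t : LambdaTerm) : Prop := ClosedUnder 0 t

/-- If the term is placed below a path of unary nodes, numbered `0, 1, 2, …` from bottom to top,
this is the number of its leaves that are bound by the unary node number `d`. -/
def pointers : ℕ → LambdaTerm → ℕ
  | d, var k => if k = d then 1 else 0
  | d, abs t => pointers (d + 1) t
  | d, app s t => pointers d s + pointers d t

/-- Each unary node of the term binds at most `p` leaves. -/
def BindsAtMost (p : ℕ) : LambdaTerm → Prop
  | var _ => True
  | abs t => pointers 0 t ≤ p ∧ BindsAtMost p t
  | app s t => BindsAtMost p s ∧ BindsAtMost p t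

end LambdaTerm

/-- The set of `BCK(p)`-terms. -/
def BCK (p : ℕ) : Set LambdaTerm := {t | t.IsClosed ∧ t.BindsAtMost p}

theorem LambdaTerm.finite_closedUnder_size (n : ℕ) :
    ∀ d : ℕ, {t : LambdaTerm | t.ClosedUnder d ∧ t.size ≤ n}.Finite := by
  induction n with
  | zero =>
    intro d
    refine Set.finite_empty.subset ?_
    rintro (k | t | ⟨s, t⟩) ⟨_, h⟩ <;> simp only [LambdaTerm.size] at h <;> omega
  | succ n ih =>
    intro d
    refine (((Set.finite_lt_nat d).image LambdaTerm.var).union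
      (((ih (d + 1)).image LambdaTerm.abs).union
        ((ih d).image2 LambdaTerm.app (ih d)))).subset ?_
    rintro (k | t | ⟨s, t⟩) ⟨hc, h⟩ <;> simp only [LambdaTerm.size] at h
    · exact Or.inl ⟨k, hc, rfl⟩
    · exact Or.inr (Or.inl ⟨t, ⟨hc, by omega⟩, rfl⟩)
    · exact Or.inr (Or.inr ⟨s, ⟨hc.1, by omega⟩, t, ⟨hc.2, by omega⟩, rfl⟩)

/-- There are only finitely many `BCK(p)`-terms of each size. -/
theorem BCK_finite (p n : ℕ) : {t ∈ BCK p | t.size = n}.Finite :=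
  (LambdaTerm.finite_closedUnder_size n 0).subset fun _ h => ⟨h.1.1, h.2.le⟩

/-- The number of `BCK(p)`-terms of size `n`. -/
noncomputable def bckCount (p n : ℕ) : ℕ := {t ∈ BCK p | t.size = n}.ncard

/-- The generating function of `BCK(p)`-terms. -/
noncomputable def bckGF (p : ℕ) : PowerSeries ℝ := PowerSeries.mk fun n => (bckCount p n : ℝ)

/-- `α_{l,p}`: the sum over all `(s_1, …, s_p)` with `∑ s_i = l` and `∑ i s_i = p` of the
multinomial coefficient `l! / (s_1! ⋯ s_p!)` times the product of the `(2m choose m) ^ s_m`. -/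
def alphaCoeff (l p : ℕ) : ℕ :=
  ∑ s ∈ (Finset.piAntidiag (Finset.Icc 1 p) l).filter
      (fun s => ∑ i ∈ Finset.Icc 1 p, i * s i = p),
    Nat.multinomial (Finset.Icc 1 p) s * ∏ m ∈ Finset.Icc 1 p, (Nat.choose (2 * m) m) ^ s m

/-- The differential operator `Δ_p = ∑_{l=1}^p (α_{l,p} / l!) z^{l+2p+1} D^l`. -/
noncomputable def deltaOp (p : ℕ) (F : PowerSeries ℝ) : PowerSeries ℝ :=
  ∑ l ∈ Finset.Icc 1 p,
    PowerSeries.C ((alphaCoeff l p : ℝ) / (Nat.factorial l : ℝ)) *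
      PowerSeries.X ^ (l + 2 * p + 1) * (PowerSeries.derivative ℝ)^[l] F

/-- `Y = ∑_{l=1}^p C_{l-1} z^{2l} + z Y² + (∑_{l=1}^p Δ_l) Y`, with Catalan numbers `C_{l-1}`. -/
def BCKEquation (p : ℕ) (Y : PowerSeries ℝ) : Prop :=
  Y = ∑ l ∈ Finset.Icc 1 p, PowerSeries.C (catalan (l - 1) : ℝ) * PowerSeries.X ^ (2 * l)
    + PowerSeries.X * Y ^ 2 + ∑ l ∈ Finset.Icc 1 p, deltaOp l Y

/-! The series `Y` is the generating function of the closed terms in which every unary node binds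
between 1 and `p` leaves. Its coefficients are cardinalities, hence nonnegative.

Equation. Such a term is an application, giving `z Y²`, or an abstraction whose root binds `k`
leaves, `1 ≤ k ≤ p`. In the latter case erase these `k` leaves, each with one binary node. Either
nothing is left, so that the body is a binary tree with `k` leaves (Catalan number), or a closed
term `u` of the same kind is left. To reverse the erasure, hang above each node of `u` a sequence of
pure binary trees, each on the left or on the right. With `Q = x C(x)` one node contributes `1/(1 -
2Q) = B(x)`, the central binomial series, so a term of size `m` has `[x^k] B^m` preimages
(`weightGF_insertions`). Expanding `B^m = (1 + (B - 1))^m` gives `∑ α_{l,k} (m choose l)`, and `z^l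
D^l / l!` multiplies the coefficient of `z^m` by `m choose l`; this is `Δ_k` (`deltaOp_eq`).

Uniqueness. The `n`-th coefficient of the right-hand side involves only earlier coefficients of `Y`.

Substitution. Deleting the unary nodes that bind nothing maps `BCK(p)`-terms onto the terms counted
by `Y`. Each remaining node had an arbitrary chain of deleted nodes above it, so `z` becomes `z/(1 -
z)` (`weightGF_paddings`). -/

open PowerSeries

/-! ### Generating functions of weighted sets -/

section GeneratingFunctions

theorem Set.Finite.ncard_eq_sum_fiberwise {α β : Type*} [DecidableEq β] {S : Set α}
    (hS : S.Finite) (T : Finset β) (f : α → β) (h : ∀ a ∈ S, f a ∈ T) :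
    S.ncard = ∑ b ∈ T, {a ∈ S | f a = b}.ncard := by
  classical
  rw [Set.ncard_eq_toFinset_card S hS,
    Finset.card_eq_sum_card_fiberwise (f := f) (t := T) (by simpa [Set.MapsTo] using h)]
  refine Finset.sum_congr rfl fun b _ => ?_
  rw [← Set.ncard_coe_finset]
  congr 1
  ext a
  simp

/-- The generating function of the elements of `S`, with respect to the weight `w`. -/
noncomputable def weightGF {α : Type*} (S : Set α) (w : α → ℕ) : ℝ⟦X⟧ :=
  PowerSeries.mk fun n => ({a ∈ S | w a = n}.ncard : ℝ)

/-- The set `S` has finitely many elements of each weight. -/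
def FiniteFibers {α : Type*} (S : Set α) (w : α → ℕ) : Prop :=
  ∀ n, {a ∈ S | w a = n}.Finite

variable {α β γ : Type*}

@[simp]
theorem coeff_weightGF (S : Set α) (w : α → ℕ) (n : ℕ) :
    coeff n (weightGF S w) = ({a ∈ S | w a = n}.ncard : ℝ) := by
  simp [weightGF]

theorem FiniteFibers.mono {S T : Set α} {w : α → ℕ} (h : FiniteFibers T w) (hST : S ⊆ T) :
    FiniteFibers S w :=
  fun n => (h n).subset fun _ ha => ⟨hST ha.1, ha.2⟩

theorem weightGF_singleton (a : α) (w : α → ℕ) : weightGF {a} w = X ^ w a := by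
  ext n
  rw [coeff_weightGF, coeff_X_pow]
  split_ifs with h
  · rw [show {b ∈ ({a} : Set α) | w b = n} = {a} by ext; simp; rintro rfl; exact h.symm]
    simp
  · rw [show {b ∈ ({a} : Set α) | w b = n} = ∅ by ext; simp; rintro rfl; exact Ne.symm h]
    simp

theorem weightGF_union {S T : Set α} {w : α → ℕ} (hS : FiniteFibers S w)
    (hT : FiniteFibers T w) (h : Disjoint S T) :
    weightGF (S ∪ T) w = weightGF S w + weightGF T w := by
  ext n
  simp only [coeff_weightGF, map_add]
  rw [← Nat.cast_add, ← Set.ncard_union_eq _ (hS n) (hT n)]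
  · congr 2
    ext a
    simp [or_and_right]
  · exact h.mono (fun _ ha => ha.1) (fun _ ha => ha.1)

theorem weightGF_image {f : α → β} (hf : Function.Injective f) {w : α → ℕ} {w' : β → ℕ} {c : ℕ}
    {S : Set α} (h : ∀ a ∈ S, w' (f a) = w a + c) :
    weightGF (f '' S) w' = X ^ c * weightGF S w := by
  ext n
  rw [coeff_weightGF, coeff_X_pow_mul']
  split_ifs with hc
  · rw [coeff_weightGF, ← Set.ncard_image_of_injective _ hf]
    congr 2
    ext b
    constructor
    · rintro ⟨⟨a, ha, rfl⟩, hb⟩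
      exact ⟨a, ⟨ha, by have := h a ha; omega⟩, rfl⟩
    · rintro ⟨a, ⟨ha, hw⟩, rfl⟩
      exact ⟨⟨a, ha, rfl⟩, by have := h a ha; omega⟩
  · rw [show {b ∈ f '' S | w' b = n} = ∅ from ?_]
    · simp
    · ext b
      simp only [Set.mem_ofPred_eq, Set.mem_empty_iff_false, iff_false]
      rintro ⟨⟨a, ha, rfl⟩, hb⟩
      have := h a ha
      omega

theorem FiniteFibers.prod {S : Set α} {T : Set β} {u : α → ℕ} {v : β → ℕ}
    (hS : FiniteFibers S u) (hT : FiniteFibers T v) :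
    FiniteFibers (S ×ˢ T) (fun x => u x.1 + v x.2) := by
  intro n
  refine ((Finset.HasAntidiagonal.antidiagonal n).finite_toSet.biUnion
    (fun ij _ => (hS ij.1).prod (hT ij.2))).subset ?_
  rintro ⟨a, b⟩ ⟨⟨ha, hb⟩, hn⟩
  simp only [Set.mem_iUnion]
  exact ⟨(u a, v b), by simpa using hn, ⟨ha, rfl⟩, ⟨hb, rfl⟩⟩

theorem weightGF_prod {S : Set α} {T : Set β} {u : α → ℕ} {v : β → ℕ}
    (hS : FiniteFibers S u) (hT : FiniteFibers T v) :
    weightGF (S ×ˢ T) (fun x => u x.1 + v x.2) = weightGF S u * weightGF T v := by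
  ext n
  rw [coeff_weightGF, coeff_mul, (hS.prod hT n).ncard_eq_sum_fiberwise (Finset.HasAntidiagonal.antidiagonal n)
    (fun x => (u x.1, v x.2)) (by simp)]
  push_cast
  refine Finset.sum_congr rfl fun ij hij => ?_
  rw [coeff_weightGF, coeff_weightGF, ← Nat.cast_mul, ← Set.ncard_prod]
  congr 2
  ext ⟨a, b⟩
  simp only [Finset.HasAntidiagonal.mem_antidiagonal] at hij
  simp only [Set.mem_prod, Set.mem_ofPred_eq, Prod.ext_iff]
  constructor
  · rintro ⟨⟨h1, -⟩, h2⟩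
    exact ⟨⟨h1.1, h2.1⟩, h1.2, h2.2⟩
  · rintro ⟨h1, h2⟩
    exact ⟨⟨⟨h1.1, h2.1⟩, by rw [h1.2, h2.2, hij]⟩, h1.2, h2.2⟩

theorem weightGF_image2 {f : α → β → γ} (hf : Function.Injective2 f) {u : α → ℕ} {v : β → ℕ}
    {w : γ → ℕ} {c : ℕ} {S : Set α} {T : Set β} (hS : FiniteFibers S u) (hT : FiniteFibers T v)
    (h : ∀ a b, w (f a b) = u a + v b + c) :
    weightGF (Set.image2 f S T) w = X ^ c * (weightGF S u * weightGF T v) := by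
  rw [← weightGF_prod hS hT, ← Set.image_uncurry_prod,
    weightGF_image hf.uncurry (c := c) (w := fun x => u x.1 + v x.2)]
  rintro ⟨a, b⟩ _
  exact h a b

end GeneratingFunctions

/-! ### Erasing all leaves of one index -/

theorem X_mul_catalanSeries_eq :
    X * catalanSeries.map (Nat.castRingHom ℝ) =
      X + (X * catalanSeries.map (Nat.castRingHom ℝ)) ^ 2 := by
  have := congrArg (PowerSeries.map (Nat.castRingHom ℝ)) catalanSeries_sq_mul_X_add_one
  simp only [map_add, map_mul, map_pow, map_one, PowerSeries.map_X] at this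
  nth_rewrite 1 [← this]
  ring

namespace LambdaTerm

theorem app_injective2 : Function.Injective2 app := fun _ _ _ _ h => by simpa using h

theorem abs_injective : Function.Injective abs := fun _ _ h => by simpa using h

theorem ClosedUnder.mono {t : LambdaTerm} : ∀ {d e : ℕ}, d ≤ e → t.ClosedUnder d →
    t.ClosedUnder e := by
  induction t with
  | var k => intro d e h hk; exact lt_of_lt_of_le hk h
  | abs t ih => intro d e h hk; exact ih (Nat.succ_le_succ h) hk
  | app s t ihs iht => intro d e h hk; exact ⟨ihs h hk.1, iht h hk.2⟩

/-- A set of terms with a common bound on the free indices has finitely many elements of each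
weight if the weight controls the size. -/
theorem finiteFibers_of_closedUnder {S : Set LambdaTerm} {w : LambdaTerm → ℕ} (d : ℕ) (b : ℕ → ℕ)
    (h : ∀ t ∈ S, t.ClosedUnder d ∧ t.size ≤ b (w t)) : FiniteFibers S w := by
  intro n
  refine (finite_closedUnder_size (b n) d).subset ?_
  rintro t ⟨ht, rfl⟩
  exact h t ht

/-- Each unary node of the term binds at least one and at most `p` leaves. -/
def BindsBetween (p : ℕ) : LambdaTerm → Prop
  | var _ => True
  | abs t => (1 ≤ pointers 0 t ∧ pointers 0 t ≤ p) ∧ BindsBetween p t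
  | app s t => BindsBetween p s ∧ BindsBetween p t

/-- Delete all leaves with index `i`, together with the binary nodes above them; the result is
`none` if no leaf is left. -/
def eraseVar : ℕ → LambdaTerm → Option LambdaTerm
  | i, var k => if k = i then none else some (var (if k < i then k else k - 1))
  | i, abs t => (eraseVar (i + 1) t).map abs
  | i, app s t =>
    match eraseVar i s, eraseVar i t with
    | none, x => x
    | some s', none => some s'
    | some s', some t' => some (app s' t')

theorem eraseVar_app_eq_none {i : ℕ} {s t : LambdaTerm} :
    eraseVar i (app s t) = none ↔ eraseVar i s = none ∧ eraseVar i t = none := by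
  rw [eraseVar]
  split <;> simp_all

theorem eraseVar_app_eq_some {i : ℕ} {s t u : LambdaTerm} :
    eraseVar i (app s t) = some u ↔
      (eraseVar i s = none ∧ eraseVar i t = some u) ∨
      (eraseVar i s = some u ∧ eraseVar i t = none) ∨
      ∃ s' t', eraseVar i s = some s' ∧ eraseVar i t = some t' ∧ app s' t' = u := by
  rw [eraseVar]
  split <;> simp_all

/-- A unary node cannot occur: it would have to bind a leaf, and that leaf would survive. So `t` is
a binary tree with all leaves of index `i`. -/
theorem eraseVar_eq_none {p : ℕ} {t : LambdaTerm} : ∀ {i : ℕ}, t.BindsBetween p →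
    t.eraseVar i = none →
      (∀ j, j ≠ i → pointers j t = 0) ∧ t.size + 1 = 2 * pointers i t ∧ t.ClosedUnder (i + 1) := by
  induction t with
  | var k =>
    intro i _ h
    have hk : k = i := by by_contra hne; simp [eraseVar, hne] at h
    subst hk
    simp only [pointers, size, ClosedUnder]
    refine ⟨fun j hj => if_neg (Ne.symm hj), by simp, Nat.lt_succ_self _⟩
  | abs t ih =>
    intro i hp h
    have h0 := (ih hp.2 (by simpa [eraseVar] using h)).1 0 (by omega)
    have := hp.1.1
    omega
  | app s t ihs iht =>
    intro i hp h
    rw [eraseVar_app_eq_none] at h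
    obtain ⟨hs1, hs2, hs3⟩ := ihs hp.1 h.1
    obtain ⟨ht1, ht2, ht3⟩ := iht hp.2 h.2
    refine ⟨fun j hj => ?_, ?_, hs3, ht3⟩
    · simp only [pointers, hs1 j hj, ht1 j hj]
    · simp only [size, pointers]; omega

/-- Each erased leaf takes exactly one binary node with it, whence the factor 2. All other pointers
are kept, so the binding bounds survive. -/
theorem eraseVar_eq_some {p : ℕ} {t : LambdaTerm} : ∀ {i : ℕ} {u : LambdaTerm},
    t.BindsBetween p → t.eraseVar i = some u →
      u.BindsBetween p ∧ t.size = u.size + 2 * pointers i t ∧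
      (∀ j < i, pointers j u = pointers j t) ∧ (∀ j ≥ i, pointers j u = pointers (j + 1) t) ∧
      (∀ d ≥ i, t.ClosedUnder (d + 1) ↔ u.ClosedUnder d) := by
  induction t with
  | var k =>
    intro i u _ h
    by_cases hk : k = i
    · simp [eraseVar, hk] at h
    · simp only [eraseVar, hk, if_false, Option.some.injEq] at h
      subst h
      refine ⟨trivial, by simp [size, pointers, hk], fun j hj => ?_, fun j hj => ?_,
        fun d hd => ?_⟩
      · simp only [pointers]; grind
      · simp only [pointers]; grind
      · simp only [ClosedUnder]; grind
  | abs t ih =>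
    intro i u hp h
    simp only [eraseVar, Option.map_eq_some_iff] at h
    obtain ⟨v, hv, rfl⟩ := h
    obtain ⟨h1, h2, h3, h4, h5⟩ := ih hp.2 hv
    refine ⟨⟨?_, h1⟩, ?_, fun j hj => ?_, fun j hj => ?_, fun d hd => ?_⟩
    · rw [h3 0 (by omega)]; exact hp.1
    · simp only [size, pointers]; omega
    · exact h3 _ (by omega)
    · exact h4 _ (by omega)
    · exact h5 _ (by omega)
  | app s t ihs iht =>
    intro i u hp h
    rw [eraseVar_app_eq_some] at h
    rcases h with ⟨hs, ht⟩ | ⟨hs, ht⟩ | ⟨s', t', hs, ht, rfl⟩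
    · obtain ⟨a1, a2, a3⟩ := eraseVar_eq_none hp.1 hs
      obtain ⟨h1, h2, h3, h4, h5⟩ := iht hp.2 ht
      refine ⟨h1, by simp only [size, pointers]; omega, fun j hj => ?_, fun j hj => ?_,
        fun d hd => ?_⟩
      · simp only [pointers, a1 j (by omega), h3 j hj, zero_add]
      · simp only [pointers, a1 (j + 1) (by omega), h4 j hj, zero_add]
      · simp only [ClosedUnder, h5 d hd, a3.mono (Nat.succ_le_succ hd), true_and]
    · obtain ⟨a1, a2, a3⟩ := eraseVar_eq_none hp.2 ht
      obtain ⟨h1, h2, h3, h4, h5⟩ := ihs hp.1 hs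
      refine ⟨h1, by simp only [size, pointers]; omega, fun j hj => ?_, fun j hj => ?_,
        fun d hd => ?_⟩
      · simp only [pointers, a1 j (by omega), h3 j hj, add_zero]
      · simp only [pointers, a1 (j + 1) (by omega), h4 j hj, add_zero]
      · simp only [ClosedUnder, h5 d hd, a3.mono (Nat.succ_le_succ hd), and_true]
    · obtain ⟨h1, h2, h3, h4, h5⟩ := ihs hp.1 hs
      obtain ⟨k1, k2, k3, k4, k5⟩ := iht hp.2 ht
      refine ⟨⟨h1, k1⟩, by simp only [size, pointers]; omega, fun j hj => ?_, fun j hj => ?_,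
        fun d hd => ?_⟩
      · simp only [pointers, h3 j hj, k3 j hj]
      · simp only [pointers, h4 j hj, k4 j hj]
      · simp only [ClosedUnder, h5 d hd, k5 d hd]

/-- The terms that consist of applications and of leaves with index `i`. -/
def pureTerms (p i : ℕ) : Set LambdaTerm := {t | t.BindsBetween p ∧ t.eraseVar i = none}

/-- The terms that become `u` when the leaves with index `i` are deleted. -/
def insertions (p i : ℕ) (u : LambdaTerm) : Set LambdaTerm :=
  {t | t.BindsBetween p ∧ t.eraseVar i = some u}

theorem finiteFibers_pureTerms (p i : ℕ) : FiniteFibers (pureTerms p i) (pointers i) := by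
  refine finiteFibers_of_closedUnder (i + 1) (fun n => 2 * n) fun t ht => ?_
  obtain ⟨-, h2, h3⟩ := eraseVar_eq_none ht.1 ht.2
  exact ⟨h3, by omega⟩

theorem finiteFibers_insertions (p : ℕ) {i d : ℕ} (hi : i ≤ d) {u : LambdaTerm}
    (hu : u.ClosedUnder d) : FiniteFibers (insertions p i u) (pointers i) := by
  refine finiteFibers_of_closedUnder (d + 1) (fun n => u.size + 2 * n) fun t ht => ?_
  obtain ⟨-, h2, -, -, h5⟩ := eraseVar_eq_some ht.1 ht.2
  exact ⟨(h5 d hi).2 hu, h2.le⟩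

theorem pureTerms_eq (p i : ℕ) :
    pureTerms p i = {var i} ∪ Set.image2 app (pureTerms p i) (pureTerms p i) := by
  ext t
  constructor
  · rintro ⟨h1, h2⟩
    cases t with
    | var k =>
      left
      by_contra hk
      have : k ≠ i := by rintro rfl; exact hk rfl
      simp [eraseVar, this] at h2
    | abs t =>
      have h0 := (eraseVar_eq_none (i := i + 1) h1.2 (by simpa [eraseVar] using h2)).1 0 (by omega)
      have := h1.1.1
      omega
    | app s t =>
      rw [eraseVar_app_eq_none] at h2
      exact Or.inr ⟨s, ⟨h1.1, h2.1⟩, t, ⟨h1.2, h2.2⟩, rfl⟩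
  · rintro (rfl | ⟨s, hs, t, ht, rfl⟩)
    · exact ⟨trivial, by simp [eraseVar]⟩
    · exact ⟨⟨hs.1, ht.1⟩, eraseVar_app_eq_none.2 ⟨hs.2, ht.2⟩⟩

theorem weightGF_pureTerms (p i : ℕ) :
    weightGF (pureTerms p i) (pointers i) = X * catalanSeries.map (Nat.castRingHom ℝ) := by
  set P := weightGF (pureTerms p i) (pointers i) with hP
  set Q : ℝ⟦X⟧ := X * catalanSeries.map (Nat.castRingHom ℝ) with hQ
  have hfin := finiteFibers_pureTerms p i
  have h1 : P = X + P ^ 2 := by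
    conv_lhs => rw [hP, pureTerms_eq]
    rw [weightGF_union, weightGF_singleton, weightGF_image2 app_injective2 (c := 0) hfin hfin]
    · simp [pointers, sq, ← hP]
    · intro a b; simp [pointers]
    · exact hfin.mono (by conv_rhs => rw [pureTerms_eq]
                          exact Set.subset_union_left)
    · exact hfin.mono (by conv_rhs => rw [pureTerms_eq]
                          exact Set.subset_union_right)
    · rw [Set.disjoint_left]
      rintro t rfl ⟨a, _, b, _, h⟩
      cases h
  have h2 : Q = X + Q ^ 2 := X_mul_catalanSeries_eq
  -- Both series solve the same quadratic; the second factor has constant term 1 and cannot vanish.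
  have h3 : (P - Q) * (1 - P - Q) = 0 := by linear_combination h1 - h2
  rcases mul_eq_zero.1 h3 with h | h
  · exact sub_eq_zero.1 h
  · exfalso
    have h4 := congrArg constantCoeff h
    have hQ0 : constantCoeff Q = 0 := by simp [hQ]
    have hP0 : constantCoeff P = 0 := by
      rw [← coeff_zero_eq_constantCoeff_apply, hP, coeff_weightGF]
      rw [show {t ∈ pureTerms p i | pointers i t = 0} = ∅ from ?_]
      · simp
      · ext t
        simp only [Set.mem_ofPred_eq, Set.mem_empty_iff_false, iff_false]
        rintro ⟨ht, h0⟩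
        have := (eraseVar_eq_none ht.1 ht.2).2.1
        omega
    simp [hQ0, hP0] at h4

end LambdaTerm

/-! ### Counting the reinsertions of leaves -/

/-- The generating function of the central binomial coefficients. -/
noncomputable def centralBinomSeries : ℝ⟦X⟧ := PowerSeries.mk fun n => (n.centralBinom : ℝ)

/-- Differentiate `Q = X + Q²`, where `Q' = B` because `(n + 1) C_n` is the central binomial
coefficient. -/
theorem centralBinomSeries_mul :
    centralBinomSeries * (1 - 2 * (X * catalanSeries.map (Nat.castRingHom ℝ))) = 1 := by
  set Q : ℝ⟦X⟧ := X * catalanSeries.map (Nat.castRingHom ℝ) with hQ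
  have h2 : Q = X + Q ^ 2 := X_mul_catalanSeries_eq
  have hB : derivative ℝ Q = centralBinomSeries := by
    ext n
    rw [coeff_derivative, hQ, coeff_succ_X_mul, centralBinomSeries, coeff_mk,
      ← succ_mul_catalan_eq_centralBinom]
    simp
    ring
  have h3 := congrArg (derivative ℝ) h2
  rw [map_add, derivative_X, sq, (derivative ℝ).leibniz Q Q, hB, smul_eq_mul] at h3
  linear_combination h3

namespace LambdaTerm

/-- The insertions of leaves with index `i` into `u` that do not add a binary node above the
root of `u`. -/
def rootInsertions (p i : ℕ) : LambdaTerm → Set LambdaTerm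
  | var k => {var (if k < i then k else k + 1)}
  | abs u => abs '' insertions p (i + 1) u
  | app u v => Set.image2 app (insertions p i u) (insertions p i v)

/-- The root of an insertion is either the root of `u` or a new binary node, one of whose two
subtrees is pure. -/
theorem insertions_eq {p : ℕ} (i : ℕ) {u : LambdaTerm} (hu : u.BindsBetween p) :
    insertions p i u = rootInsertions p i u ∪
      (Set.image2 app (pureTerms p i) (insertions p i u) ∪
        Set.image2 app (insertions p i u) (pureTerms p i)) := by
  ext t
  constructor
  · rintro ⟨h1, h2⟩
    cases t with
    | var k =>
      left
      by_cases hk : k = i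
      · simp [eraseVar, hk] at h2
      · simp only [eraseVar, hk, if_false, Option.some.injEq] at h2
        subst h2
        simp only [rootInsertions, Set.mem_singleton_iff, var.injEq]
        grind
    | abs t =>
      left
      simp only [eraseVar, Option.map_eq_some_iff] at h2
      obtain ⟨v, hv, rfl⟩ := h2
      exact ⟨t, ⟨h1.2, hv⟩, rfl⟩
    | app s t =>
      rw [eraseVar_app_eq_some] at h2
      rcases h2 with ⟨hs, ht⟩ | ⟨hs, ht⟩ | ⟨s', t', hs, ht, rfl⟩
      · exact Or.inr (Or.inl ⟨s, ⟨h1.1, hs⟩, t, ⟨h1.2, ht⟩, rfl⟩)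
      · exact Or.inr (Or.inr ⟨s, ⟨h1.1, hs⟩, t, ⟨h1.2, ht⟩, rfl⟩)
      · exact Or.inl ⟨s, ⟨h1.1, hs⟩, t, ⟨h1.2, ht⟩, rfl⟩
  · rintro (h | ⟨s, hs, t, ht, rfl⟩ | ⟨s, hs, t, ht, rfl⟩)
    · cases u with
      | var k =>
        obtain rfl := h
        refine ⟨trivial, ?_⟩
        simp only [eraseVar]
        grind
      | abs u =>
        obtain ⟨t, ht, rfl⟩ := h
        have := (eraseVar_eq_some ht.1 ht.2).2.2.1 0 (by omega)
        exact ⟨⟨this ▸ hu.1, ht.1⟩, by rw [eraseVar, ht.2]; rfl⟩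
      | app u v =>
        obtain ⟨s, hs, t, ht, rfl⟩ := h
        exact ⟨⟨hs.1, ht.1⟩, eraseVar_app_eq_some.2 (Or.inr (Or.inr ⟨u, v, hs.2, ht.2, rfl⟩))⟩
    · exact ⟨⟨hs.1, ht.1⟩, eraseVar_app_eq_some.2 (Or.inl ⟨hs.2, ht.2⟩)⟩
    · exact ⟨⟨hs.1, ht.1⟩, eraseVar_app_eq_some.2 (Or.inr (Or.inl ⟨hs.2, ht.2⟩))⟩

/-- The decomposition reads `A = R + 2QA`, so `A = R/(1 - 2Q) = B R`. -/
theorem weightGF_insertions_eq_root {p i d : ℕ} (hi : i ≤ d) {u : LambdaTerm}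
    (hu : u.BindsBetween p) (hd : u.ClosedUnder d) :
    weightGF (insertions p i u) (pointers i) =
      centralBinomSeries * weightGF (rootInsertions p i u) (pointers i) := by
  have hA := finiteFibers_insertions p hi hd
  have hP := finiteFibers_pureTerms p i
  have hR : FiniteFibers (rootInsertions p i u) (pointers i) := by
    refine hA.mono ?_
    rw [insertions_eq i hu]
    exact Set.subset_union_left
  have hL : FiniteFibers (Set.image2 app (pureTerms p i) (insertions p i u)) (pointers i) := by
    refine hA.mono ?_
    conv_rhs => rw [insertions_eq i hu]
    exact Set.subset_union_left.trans Set.subset_union_right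
  have hM : FiniteFibers (Set.image2 app (insertions p i u) (pureTerms p i)) (pointers i) := by
    refine hA.mono ?_
    conv_rhs => rw [insertions_eq i hu]
    exact Set.subset_union_right.trans Set.subset_union_right
  have hLM : FiniteFibers (Set.image2 app (pureTerms p i) (insertions p i u) ∪
      Set.image2 app (insertions p i u) (pureTerms p i)) (pointers i) := by
    refine hA.mono ?_
    conv_rhs => rw [insertions_eq i hu]
    exact Set.subset_union_right
  have h1 : weightGF (insertions p i u) (pointers i) =
      weightGF (rootInsertions p i u) (pointers i) +
        2 * (X * catalanSeries.map (Nat.castRingHom ℝ)) *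
          weightGF (insertions p i u) (pointers i) := by
    conv_lhs => rw [insertions_eq i hu]
    rw [weightGF_union hR hLM, weightGF_union hL hM,
      weightGF_image2 app_injective2 (c := 0) hP hA (fun _ _ => rfl),
      weightGF_image2 app_injective2 (c := 0) hA hP (fun _ _ => rfl), weightGF_pureTerms]
    · ring
    · rw [Set.disjoint_left]
      rintro t ⟨a, ha, b, hb, rfl⟩ ⟨a', ha', b', hb', h⟩
      obtain ⟨rfl, rfl⟩ := app_injective2 h
      simpa [ha.2] using ha'.2
    · rw [Set.disjoint_left]
      rintro t ht h
      -- A new root has a subtree that is erased completely; below the old root both subtrees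
      -- survive.
      have key : ∃ a b, t = app a b ∧ (eraseVar i a = none ∨ eraseVar i b = none) := by
        rcases h with ⟨a, ha, b, hb, rfl⟩ | ⟨a, ha, b, hb, rfl⟩
        · exact ⟨a, b, rfl, Or.inl ha.2⟩
        · exact ⟨a, b, rfl, Or.inr hb.2⟩
      obtain ⟨a, b, rfl, hab⟩ := key
      cases u with
      | var k => cases ht
      | abs u => obtain ⟨_, _, h⟩ := ht; cases h
      | app u v =>
        obtain ⟨a', ha', b', hb', h⟩ := ht
        obtain ⟨rfl, rfl⟩ := app_injective2 h
        simp [ha'.2, hb'.2] at hab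
  linear_combination centralBinomSeries * h1 -
    weightGF (insertions p i u) (pointers i) * centralBinomSeries_mul

/-- The insertions of `k` leaves into a term of size `n` are counted by the `k`-th coefficient of
the `n`-th power of the generating function of the central binomial coefficients. -/
theorem weightGF_insertions {p : ℕ} {u : LambdaTerm} : ∀ {i d : ℕ}, i ≤ d → u.BindsBetween p →
    u.ClosedUnder d →
      weightGF (insertions p i u) (pointers i) = centralBinomSeries ^ u.size := by
  induction u with
  | var k =>
    intro i d hi hu hd
    -- Every node of `u` contributes one factor `B`; the shifted leaf itself never has index `i`, so
    -- its weight is 0.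
    rw [weightGF_insertions_eq_root hi hu hd, rootInsertions, weightGF_singleton]
    have : pointers i (var (if k < i then k else k + 1)) = 0 := by
      simp only [pointers]; grind
    rw [this, size, pow_zero, mul_one, pow_one]
  | abs u ih =>
    intro i d hi hu hd
    rw [weightGF_insertions_eq_root hi hu hd, rootInsertions,
      weightGF_image abs_injective (c := 0) (w := pointers (i + 1)) (fun _ _ => rfl),
      ih (Nat.succ_le_succ hi) hu.2 hd, size]
    ring
  | app u v ihu ihv =>
    intro i d hi hu hd
    rw [weightGF_insertions_eq_root hi hu hd, rootInsertions,
      weightGF_image2 app_injective2 (c := 0) (finiteFibers_insertions p hi hd.1)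
        (finiteFibers_insertions p hi hd.2) (fun _ _ => rfl),
      ihu hi hu.1 hd.1, ihv hi hu.2 hd.2, size]
    ring

end LambdaTerm

/-! ### Deleting and restoring the unary nodes that bind nothing -/

namespace LambdaTerm

/-- Raise by one all indices from `c` on. -/
def lift : ℕ → LambdaTerm → LambdaTerm
  | c, var k => var (if k < c then k else k + 1)
  | c, abs t => abs (lift (c + 1) t)
  | c, app s t => app (lift c s) (lift c t)

/-- Lower by one all indices above `c`. -/
def lower : ℕ → LambdaTerm → LambdaTerm
  | c, var k => var (if k ≤ c then k else k - 1)
  | c, abs t => abs (lower (c + 1) t)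
  | c, app s t => app (lower c s) (lower c t)

/-- Delete all unary nodes that bind no leaf. -/
def prune : LambdaTerm → LambdaTerm
  | var k => var k
  | abs t => if pointers 0 t = 0 then lower 0 (prune t) else abs (prune t)
  | app s t => app (prune s) (prune t)

theorem lower_lift (t : LambdaTerm) : ∀ c, lower c (lift c t) = t := by
  induction t with
  | var k => intro c; simp only [lift, lower, var.injEq]; grind
  | abs t ih => intro c; simp only [lift, lower, ih]
  | app s t ihs iht => intro c; simp only [lift, lower, ihs, iht]

theorem lift_injective (c : ℕ) : Function.Injective (lift c) :=
  Function.LeftInverse.injective fun t => lower_lift t c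

theorem lift_lower {t : LambdaTerm} : ∀ {c}, pointers c t = 0 → lift c (lower c t) = t := by
  induction t with
  | var k => intro c h; simp only [pointers, lift, lower, var.injEq] at h ⊢; grind
  | abs t ih => intro c h; simp only [lift, lower, ih h]
  | app s t ihs iht =>
    intro c h
    simp only [pointers, Nat.add_eq_zero_iff] at h
    simp only [lift, lower, ihs h.1, iht h.2]

theorem pointers_lift_self (t : LambdaTerm) : ∀ c, pointers c (lift c t) = 0 := by
  induction t with
  | var k => intro c; simp only [pointers, lift]; grind
  | abs t ih => intro c; simp only [pointers, lift, ih]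
  | app s t ihs iht => intro c; simp only [pointers, lift, ihs, iht]

theorem pointers_lift_of_lt (t : LambdaTerm) : ∀ {c d}, d < c →
    pointers d (lift c t) = pointers d t := by
  induction t with
  | var k => intro c d h; simp only [pointers, lift]; grind
  | abs t ih => intro c d h; simp only [pointers, lift, ih (Nat.succ_lt_succ h)]
  | app s t ihs iht => intro c d h; simp only [pointers, lift, ihs h, iht h]

theorem pointers_lift_of_le (t : LambdaTerm) : ∀ {c d}, c ≤ d →
    pointers (d + 1) (lift c t) = pointers d t := by
  induction t with
  | var k => intro c d h; simp only [pointers, lift]; grind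
  | abs t ih => intro c d h; simp only [pointers, lift, ih (Nat.succ_le_succ h)]
  | app s t ihs iht => intro c d h; simp only [pointers, lift, ihs h, iht h]

theorem size_lift (t : LambdaTerm) : ∀ c, (lift c t).size = t.size := by
  induction t with
  | var k => intro c; rfl
  | abs t ih => intro c; simp only [size, lift, ih]
  | app s t ihs iht => intro c; simp only [size, lift, ihs, iht]

theorem closedUnder_lift {t : LambdaTerm} : ∀ {c d}, c ≤ d →
    ((lift c t).ClosedUnder (d + 1) ↔ t.ClosedUnder d) := by
  induction t with
  | var k => intro c d h; simp only [ClosedUnder, lift]; grind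
  | abs t ih => intro c d h; exact ih (Nat.succ_le_succ h)
  | app s t ihs iht => intro c d h; exact and_congr (ihs h) (iht h)

theorem bindsBetween_lift {p : ℕ} {t : LambdaTerm} : ∀ {c},
    (lift c t).BindsBetween p ↔ t.BindsBetween p := by
  induction t with
  | var k => intro c; rfl
  | abs t ih =>
    intro c
    simp only [BindsBetween, lift, ih, pointers_lift_of_lt t (Nat.succ_pos c)]
  | app s t ihs iht => intro c; exact and_congr ihs iht

theorem lift_lift (t : LambdaTerm) : ∀ {b c}, b ≤ c →
    lift (c + 1) (lift b t) = lift b (lift c t) := by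
  induction t with
  | var k => intro b c h; simp only [lift, var.injEq]; grind
  | abs t ih => intro b c h; simp only [lift, ih (Nat.succ_le_succ h)]
  | app s t ihs iht => intro b c h; simp only [lift, ihs h, iht h]

/-- `prune` applies `lower` only where the index is absent, so writing the term as a `lift` reduces
everything to facts about `lift`. -/
theorem exists_eq_lift {c : ℕ} {t : LambdaTerm} (h : pointers c t = 0) : ∃ u, t = lift c u :=
  ⟨_, (lift_lower h).symm⟩

/-- No leaf is deleted, so pruning never creates a new unary node without leaves. -/
theorem pointers_prune (t : LambdaTerm) : ∀ d, pointers d (prune t) = pointers d t := by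
  induction t with
  | var k => intro d; rfl
  | abs t ih =>
    intro d
    rw [prune]
    split_ifs with h
    · obtain ⟨u, hu⟩ := exists_eq_lift ((ih 0).trans h)
      rw [pointers, ← ih, hu, lower_lift, pointers_lift_of_le u (Nat.zero_le d)]
    · exact ih _
  | app s t ihs iht => intro d; simp only [prune, pointers, ihs, iht]

theorem prune_lift (t : LambdaTerm) : ∀ c, prune (lift c t) = lift c (prune t) := by
  induction t with
  | var k => intro c; rfl
  | abs t ih =>
    intro c
    rw [lift, prune, pointers_lift_of_lt t (Nat.succ_pos c), prune, ih]
    split_ifs with h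
    · obtain ⟨u, hu⟩ := exists_eq_lift ((pointers_prune t 0).trans h)
      rw [hu, lift_lift u (Nat.zero_le c), lower_lift, lower_lift]
    · rfl
  | app s t ihs iht => intro c; simp only [prune, lift, ihs, iht]

theorem closedUnder_prune {t : LambdaTerm} : ∀ {d}, (prune t).ClosedUnder d ↔ t.ClosedUnder d := by
  induction t with
  | var k => intro d; rfl
  | abs t ih =>
    intro d
    rw [prune]
    split_ifs with h
    · obtain ⟨u, hu⟩ := exists_eq_lift ((pointers_prune t 0).trans h)
      rw [ClosedUnder, ← ih, hu, lower_lift, closedUnder_lift (Nat.zero_le d)]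
    · exact ih
  | app s t ihs iht => intro d; exact and_congr ihs iht

theorem bindsBetween_prune {p : ℕ} {t : LambdaTerm} :
    (prune t).BindsBetween p ↔ t.BindsAtMost p := by
  induction t with
  | var k => rfl
  | abs t ih =>
    rw [prune]
    split_ifs with h
    · obtain ⟨u, hu⟩ := exists_eq_lift ((pointers_prune t 0).trans h)
      rw [BindsAtMost, ← ih, hu, lower_lift, bindsBetween_lift, h]
      simp
    · rw [BindsAtMost, ← ih, BindsBetween, pointers_prune]
      have : 1 ≤ pointers 0 t := by omega
      simp [this]
  | app s t ihs iht => exact and_congr ihs iht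

theorem size_prune_le (t : LambdaTerm) : (prune t).size ≤ t.size := by
  induction t with
  | var k => exact le_rfl
  | abs t ih =>
    rw [prune]
    split_ifs with h
    · obtain ⟨u, hu⟩ := exists_eq_lift ((pointers_prune t 0).trans h)
      rw [hu, size_lift] at ih
      rw [hu, lower_lift, size]
      omega
    · simp only [size]; omega
  | app s t ihs iht => simp only [prune, size]; omega

/-- The terms that become `u` when all unary nodes that bind no leaf are deleted. -/
def paddings (u : LambdaTerm) : Set LambdaTerm := {t | prune t = u}

/-- The elements of `paddings u` whose root is not a unary node that binds no leaf. -/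
def rootPaddings : LambdaTerm → Set LambdaTerm
  | var k => {var k}
  | abs u => abs '' paddings u
  | app u v => Set.image2 app (paddings u) (paddings v)

theorem finiteFibers_paddings {d : ℕ} {u : LambdaTerm} (hu : u.ClosedUnder d) :
    FiniteFibers (paddings u) size := by
  refine finiteFibers_of_closedUnder d id ?_
  rintro t rfl
  exact ⟨closedUnder_prune.1 hu, le_rfl⟩

theorem pointers_ne_zero_of_mem_rootPaddings {p : ℕ} {u t : LambdaTerm} (hu : u.BindsBetween p)
    (h : abs t ∈ rootPaddings u) : pointers 0 t ≠ 0 := by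
  cases u with
  | var k => cases h
  | abs u =>
    obtain ⟨s, hs, h⟩ := h
    obtain rfl := abs_injective h
    have := hu.1.1
    rw [← hs, pointers_prune] at this
    omega
  | app u v => obtain ⟨_, _, _, _, h⟩ := h; cases h

theorem paddings_eq {p : ℕ} {u : LambdaTerm} (hu : u.BindsBetween p) :
    paddings u = rootPaddings u ∪ (fun t => abs (lift 0 t)) '' paddings u := by
  ext t
  constructor
  · rintro rfl
    cases t with
    | var k => exact Or.inl rfl
    | abs t =>
      by_cases h : pointers 0 t = 0
      · obtain ⟨s, rfl⟩ := exists_eq_lift h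
        refine Or.inr ⟨s, ?_, rfl⟩
        rw [paddings, Set.mem_ofPred_eq, prune, if_pos h, prune_lift, lower_lift]
      · left
        rw [prune, if_neg h]
        exact ⟨t, rfl, rfl⟩
    | app s t => exact Or.inl ⟨s, rfl, t, rfl, rfl⟩
  · rintro (h | ⟨s, rfl, rfl⟩)
    · cases u with
      | var k => obtain rfl := h; rfl
      | abs u =>
        obtain ⟨t, ht, rfl⟩ := h
        have := pointers_ne_zero_of_mem_rootPaddings hu ⟨t, ht, rfl⟩
        rw [paddings, Set.mem_ofPred_eq, prune, if_neg this, ht]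
      | app u v =>
        obtain ⟨s, hs, t, ht, rfl⟩ := h
        rw [paddings, Set.mem_ofPred_eq, prune, hs, ht]
    · simp only [paddings, Set.mem_ofPred_eq, prune, pointers_lift_self, if_true, prune_lift,
        lower_lift]

/-- Peeling one empty abstraction off the root gives `A = R + X A`. -/
theorem weightGF_paddings_eq_root {p d : ℕ} {u : LambdaTerm} (hu : u.BindsBetween p)
    (hd : u.ClosedUnder d) :
    weightGF (paddings u) size = (1 - X)⁻¹ * weightGF (rootPaddings u) size := by
  have hA := finiteFibers_paddings hd
  have h1 : weightGF (paddings u) size =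
      weightGF (rootPaddings u) size + X * weightGF (paddings u) size := by
    conv_lhs => rw [paddings_eq hu]
    rw [weightGF_union, weightGF_image (f := fun t => abs (lift 0 t))
      (abs_injective.comp (lift_injective 0)) (c := 1) (w := size),
      pow_one]
    · intro t _
      simp only [size, size_lift, add_comm]
    · refine hA.mono ?_
      rw [paddings_eq hu]
      exact Set.subset_union_left
    · refine hA.mono ?_
      conv_rhs => rw [paddings_eq hu]
      exact Set.subset_union_right
    · rw [Set.disjoint_left]
      rintro t ht ⟨s, hs, rfl⟩
      exact pointers_ne_zero_of_mem_rootPaddings hu ht (pointers_lift_self s 0)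
  have h2 : ((1 : ℝ⟦X⟧) - X)⁻¹ * (1 - X) = 1 := PowerSeries.inv_mul_cancel _ (by simp)
  linear_combination (1 - X)⁻¹ * h1 - weightGF (paddings u) size * h2

theorem weightGF_paddings {p : ℕ} {u : LambdaTerm} : ∀ {d : ℕ}, u.BindsBetween p →
    u.ClosedUnder d → weightGF (paddings u) size = (X * (1 - X)⁻¹) ^ u.size := by
  induction u with
  | var k =>
    intro d hu hd
    rw [weightGF_paddings_eq_root hu hd, rootPaddings, weightGF_singleton, size]
    ring
  | abs u ih =>
    intro d hu hd
    rw [weightGF_paddings_eq_root hu hd, rootPaddings,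
      weightGF_image abs_injective (c := 1) (w := size) (fun _ _ => Nat.add_comm _ _), ih hu.2 hd,
      size]
    ring
  | app u v ihu ihv =>
    intro d hu hd
    rw [weightGF_paddings_eq_root hu hd, rootPaddings,
      weightGF_image2 app_injective2 (c := 1) (finiteFibers_paddings hd.1)
        (finiteFibers_paddings hd.2) (fun s t => by simp only [size]; omega),
      ihu hu.1 hd.1, ihv hu.2 hd.2, size]
    ring

end LambdaTerm

/-! ### The coefficients `α`, the operators `Δ`, and uniqueness -/

section Coefficients

theorem coeff_pow_centralBinomSeries_sub_one (l k : ℕ) :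
    coeff k ((centralBinomSeries - 1) ^ l) = (alphaCoeff l k : ℝ) := by
  -- `E₀` truncates `B - 1` modulo `X^(k+1)`, which does not affect the `k`-th coefficient and makes
  -- the multinomial theorem applicable.
  set E₀ : ℝ⟦X⟧ := ∑ i ∈ Finset.Icc 1 k, C ((2 * i).choose i : ℝ) * X ^ i with hE₀
  have h1 : coeff k ((centralBinomSeries - 1) ^ l) = coeff k (E₀ ^ l) := by
    rw [← sub_eq_zero, ← map_sub]
    refine X_pow_dvd_iff.1 (dvd_trans (X_pow_dvd_iff.2 fun m hm => ?_)
      (sub_dvd_pow_sub_pow _ _ l)) k (Nat.lt_succ_self k)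
    rw [map_sub, map_sub, hE₀, map_sum, centralBinomSeries, coeff_mk, coeff_one,
      Nat.centralBinom_eq_two_mul_choose]
    simp only [coeff_C_mul, coeff_X_pow, mul_ite, mul_one, mul_zero]
    rw [Finset.sum_ite_eq]
    rcases Nat.eq_zero_or_pos m with rfl | h
    · simp
    · have : m ∈ Finset.Icc 1 k := by simp; omega
      simp [this, h.ne']
  rw [h1, hE₀, Finset.sum_pow_eq_sum_piAntidiag, map_sum, alphaCoeff, Finset.sum_filter]
  push_cast
  refine Finset.sum_congr rfl fun s _ => ?_
  have h2 : ∏ i ∈ Finset.Icc 1 k, (C ((2 * i).choose i : ℝ) * X ^ i) ^ s i =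
      C (∏ i ∈ Finset.Icc 1 k, ((2 * i).choose i : ℝ) ^ s i) *
        X ^ (∑ i ∈ Finset.Icc 1 k, i * s i) := by
    rw [map_prod, ← Finset.prod_pow_eq_pow_sum, ← Finset.prod_mul_distrib]
    refine Finset.prod_congr rfl fun i _ => ?_
    rw [mul_pow, map_pow, pow_mul]
  rw [h2, ← map_natCast (C : ℝ →+* ℝ⟦X⟧), ← mul_assoc, ← map_mul, coeff_C_mul, coeff_X_pow]
  by_cases h : ∑ i ∈ Finset.Icc 1 k, i * s i = k
  · simp [h]
  · simp [h, Ne.symm h]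

theorem coeff_pow_centralBinomSeries {k : ℕ} (hk : 1 ≤ k) (m : ℕ) :
    coeff k (centralBinomSeries ^ m) =
      ∑ l ∈ Finset.Icc 1 k, (alphaCoeff l k : ℝ) * (m.choose l : ℝ) := by
  have h0 : ∀ l, k < l → coeff k ((centralBinomSeries - 1) ^ l) = 0 := by
    intro l hl
    refine X_pow_dvd_iff.1 (pow_dvd_pow_of_dvd (X_dvd_iff.2 ?_) l) k hl
    simp [centralBinomSeries]
  calc coeff k (centralBinomSeries ^ m)
      = coeff k (((centralBinomSeries - 1) + 1) ^ m) := by rw [sub_add_cancel]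
    _ = ∑ l ∈ Finset.range (m + 1), (alphaCoeff l k : ℝ) * (m.choose l : ℝ) := by
        rw [add_pow, map_sum]
        refine Finset.sum_congr rfl fun l _ => ?_
        rw [one_pow, mul_one, ← map_natCast (C : ℝ →+* ℝ⟦X⟧), coeff_mul_C,
          coeff_pow_centralBinomSeries_sub_one]
    -- The enlarged range contains both index sets. Terms with `l > m` vanish by the binomial;
    -- below, `l = 0` vanishes since `k ≥ 1`, and `l > k` since `X^l` divides `(B - 1)^l`.
    _ = ∑ l ∈ Finset.range (m + k + 1), (alphaCoeff l k : ℝ) * (m.choose l : ℝ) := by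
        refine Finset.sum_subset (Finset.range_subset_range.2 (by omega)) fun l _ hl => ?_
        rw [Nat.choose_eq_zero_of_lt (by simpa using hl)]
        simp
    _ = ∑ l ∈ Finset.Icc 1 k, (alphaCoeff l k : ℝ) * (m.choose l : ℝ) := by
        refine (Finset.sum_subset (fun l hl => ?_) fun l _ hl => ?_).symm
        · simp only [Finset.mem_Icc, Finset.mem_range] at hl ⊢; omega
        · rw [← coeff_pow_centralBinomSeries_sub_one]
          rcases Nat.eq_zero_or_pos l with rfl | hl0
          · rw [pow_zero, coeff_one, if_neg (by omega), zero_mul]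
          · rw [h0 l (by simp only [Finset.mem_Icc] at hl; omega), zero_mul]

theorem coeff_X_pow_mul_iterate_derivative (F : ℝ⟦X⟧) (l m : ℕ) :
    coeff m (X ^ l * (derivative ℝ)^[l] F) = (m.descFactorial l : ℝ) * coeff m F := by
  rw [coeff_X_pow_mul']
  split_ifs with h
  · rw [coeff_iterate_derivative, Nat.sub_add_cancel h]
    have := Nat.add_descFactorial_eq_ascFactorial (m - l) l
    rw [Nat.sub_add_cancel h] at this
    rw [this]
  · rw [Nat.descFactorial_of_lt (by omega)]
    simp

/-- `Δ_k` is diagonal up to a shift: `z^m` goes to `[x^k] B^m · z^(m+2k+1)`. This is the form in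
which insertions are counted. -/
theorem deltaOp_eq {k : ℕ} (hk : 1 ≤ k) (F : ℝ⟦X⟧) :
    deltaOp k F =
      X ^ (2 * k + 1) * PowerSeries.mk fun m => coeff k (centralBinomSeries ^ m) * coeff m F := by
  have h : deltaOp k F = X ^ (2 * k + 1) * ∑ l ∈ Finset.Icc 1 k,
      C ((alphaCoeff l k : ℝ) / (l.factorial : ℝ)) * (X ^ l * (derivative ℝ)^[l] F) := by
    rw [deltaOp, Finset.mul_sum]
    refine Finset.sum_congr rfl fun l _ => ?_
    ring
  rw [h]
  congr 1
  ext m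
  rw [coeff_mk, map_sum, coeff_pow_centralBinomSeries hk, Finset.sum_mul]
  refine Finset.sum_congr rfl fun l _ => ?_
  rw [coeff_C_mul, coeff_X_pow_mul_iterate_derivative, Nat.descFactorial_eq_factorial_mul_choose]
  have : (l.factorial : ℝ) ≠ 0 := by exact_mod_cast l.factorial_ne_zero
  push_cast
  field_simp

/-- The factor `X` before the square and the shift by `2k + 1` in `Δ_k` make the equation a
recursion for the coefficients. -/
theorem BCKEquation.unique {p : ℕ} {F G : ℝ⟦X⟧} (hF : BCKEquation p F) (hG : BCKEquation p G) :
    F = G := by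
  ext n
  induction n using Nat.strong_induction_on with
  | _ n ih =>
    rw [BCKEquation] at hF hG
    rw [hF, hG]
    simp only [map_add, map_sum]
    congr 1
    · congr 1
      cases n with
      | zero => simp
      | succ n =>
        rw [coeff_succ_X_mul, coeff_succ_X_mul, sq, sq, coeff_mul, coeff_mul]
        refine Finset.sum_congr rfl fun ij hij => ?_
        have := Finset.HasAntidiagonal.mem_antidiagonal.1 hij
        rw [ih ij.1 (by omega), ih ij.2 (by omega)]
    · refine Finset.sum_congr rfl fun k hk => ?_
      rw [deltaOp_eq (Finset.mem_Icc.1 hk).1, deltaOp_eq (Finset.mem_Icc.1 hk).1,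
        coeff_X_pow_mul', coeff_X_pow_mul']
      split_ifs with h
      · rw [coeff_mk, coeff_mk, ih _ (by omega)]
      · rfl

end Coefficients

/-! ### The functional equation and the substitution -/

theorem weightGF_eq_sum_fiberwise {α β : Type*} [DecidableEq β] {S : Set α} {w : α → ℕ}
    (hS : FiniteFibers S w) (T : Finset β) (f : α → β) (h : ∀ a ∈ S, f a ∈ T) :
    weightGF S w = ∑ b ∈ T, weightGF {a ∈ S | f a = b} w := by
  ext n
  rw [coeff_weightGF, (hS n).ncard_eq_sum_fiberwise T f fun a ha => h a ha.1, map_sum]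
  push_cast
  refine Finset.sum_congr rfl fun b _ => ?_
  rw [coeff_weightGF]
  congr 2
  ext a
  simp only [Set.mem_ofPred_eq]
  tauto

/-- If the number of elements of `A` that `f` sends to `b ∈ S` depends only on the weight of `b`,
then the elements of `A` are counted by the elements of `S` of each weight. -/
theorem ncard_eq_sum_coeff_weightGF_mul {α β : Type*} {A : Set α} (hA : A.Finite) {S : Set β}
    {w : β → ℕ} (hS : FiniteFibers S w) (D : Finset ℕ) (f : α → β) (c : ℕ → ℝ)
    (hf : ∀ a ∈ A, f a ∈ S ∧ w (f a) ∈ D)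
    (hc : ∀ b ∈ S, w b ∈ D → ({a ∈ A | f a = b}.ncard : ℝ) = c (w b)) :
    (A.ncard : ℝ) = ∑ d ∈ D, coeff d (weightGF S w) * c d := by
  classical
  rw [hA.ncard_eq_sum_fiberwise D (fun a => w (f a)) fun a ha => (hf a ha).2]
  push_cast
  refine Finset.sum_congr rfl fun d hd => ?_
  rw [(hA.subset fun a ha => ha.1).ncard_eq_sum_fiberwise (hS d).toFinset f
    fun a ha => by simpa using ⟨(hf a ha.1).1, ha.2⟩]
  push_cast
  rw [Finset.sum_congr rfl (g := fun _ => c d), Finset.sum_const, nsmul_eq_mul, coeff_weightGF,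
    Set.ncard_eq_toFinset_card _ (hS d)]
  intro b hb
  obtain ⟨hbS, rfl⟩ : b ∈ S ∧ w b = d := by simpa using hb
  rw [← hc b hbS hd]
  congr 2
  ext a
  simp only [Set.mem_ofPred_eq]
  constructor
  · rintro ⟨⟨h1, -⟩, h2⟩
    exact ⟨h1, h2⟩
  · rintro ⟨h1, rfl⟩
    exact ⟨⟨h1, rfl⟩, rfl⟩

namespace LambdaTerm

/-- The closed terms in which each unary node binds at least one and at most `p` leaves. -/
def closedBindsBetween (p : ℕ) : Set LambdaTerm := {t | t.ClosedUnder 0 ∧ t.BindsBetween p}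

theorem finiteFibers_size (d : ℕ) : FiniteFibers {t | t.ClosedUnder d} size :=
  finiteFibers_of_closedUnder d id fun _ ht => ⟨ht, le_rfl⟩

theorem finiteFibers_closedBindsBetween (p : ℕ) : FiniteFibers (closedBindsBetween p) size :=
  (finiteFibers_size 0).mono fun _ ht => ht.1

/-- The possible subterms below a root node that is unary and binds exactly `k` leaves. -/
def bodies (p k : ℕ) : Set LambdaTerm :=
  {t | (t.ClosedUnder 1 ∧ t.BindsBetween p) ∧ pointers 0 t = k}

theorem finiteFibers_bodies (p k : ℕ) : FiniteFibers (bodies p k) size :=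
  (finiteFibers_size 1).mono fun _ ht => ht.1.1

/-- These bodies are the binary trees with `k` leaves; all have size `2k - 1`, so the series is one
monomial. -/
theorem weightGF_bodies_none (p : ℕ) {k : ℕ} (hk : 1 ≤ k) :
    weightGF {t ∈ bodies p k | t.eraseVar 0 = none} size =
      C (catalan (k - 1) : ℝ) * X ^ (2 * k - 1) := by
  have hset : {t ∈ bodies p k | t.eraseVar 0 = none} = {t ∈ pureTerms p 0 | pointers 0 t = k} := by
    ext t
    constructor
    · rintro ⟨⟨⟨_, h1⟩, h2⟩, h3⟩
      exact ⟨⟨h1, h3⟩, h2⟩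
    · rintro ⟨⟨h1, h3⟩, h2⟩
      exact ⟨⟨⟨(eraseVar_eq_none h1 h3).2.2, h1⟩, h2⟩, h3⟩
  have hsize : ∀ t ∈ {t ∈ pureTerms p 0 | pointers 0 t = k}, t.size = 2 * k - 1 := by
    rintro t ⟨⟨h1, h3⟩, h2⟩
    have := (eraseVar_eq_none h1 h3).2.1
    omega
  have hcard : ({t ∈ pureTerms p 0 | pointers 0 t = k}.ncard : ℝ) = catalan (k - 1) := by
    rw [← coeff_weightGF, weightGF_pureTerms]
    obtain ⟨k, rfl⟩ : ∃ j, k = j + 1 := ⟨k - 1, by omega⟩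
    rw [coeff_succ_X_mul]
    simp
  rw [hset]
  ext n
  rw [coeff_weightGF, coeff_C_mul, coeff_X_pow]
  split_ifs with h
  · rw [mul_one, ← hcard]
    congr 2
    ext t
    constructor
    · exact fun ht => ht.1
    · exact fun ht => ⟨ht, by rw [hsize t ht, h]⟩
  · rw [mul_zero, Nat.cast_eq_zero]
    convert Set.ncard_empty LambdaTerm
    ext t
    simp only [Set.mem_ofPred_eq, Set.mem_empty_iff_false, iff_false]
    rintro ⟨ht, rfl⟩
    exact h (hsize t ht)

theorem weightGF_bodies_some (p : ℕ) {k : ℕ} :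
    weightGF {t ∈ bodies p k | t.eraseVar 0 ≠ none} size =
      X ^ (2 * k) * PowerSeries.mk fun m =>
        coeff k (centralBinomSeries ^ m) * coeff m (weightGF (closedBindsBetween p) size) := by
  have key : ∀ t ∈ {t ∈ bodies p k | t.eraseVar 0 ≠ none},
      ∃ u ∈ closedBindsBetween p, t.eraseVar 0 = some u ∧ t.size = u.size + 2 * k := by
    rintro t ⟨⟨⟨h1, h2⟩, h3⟩, h4⟩
    obtain ⟨u, hu⟩ := Option.ne_none_iff_exists'.1 h4
    obtain ⟨a1, a2, -, -, a5⟩ := eraseVar_eq_some h2 hu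
    exact ⟨u, ⟨(a5 0 le_rfl).1 h1, a1⟩, hu, h3 ▸ a2⟩
  ext n
  rw [coeff_X_pow_mul', coeff_weightGF]
  split_ifs with hn
  · rw [coeff_mk, ncard_eq_sum_coeff_weightGF_mul
      (((finiteFibers_bodies p k).mono fun _ ht => ht.1) n)
      -- The default `var 0` is never taken, and the erased term always has size `n - 2k`.
      (finiteFibers_closedBindsBetween p) {n - 2 * k} (fun t => (t.eraseVar 0).getD (var 0))
      (fun m => coeff k (centralBinomSeries ^ m)), Finset.sum_singleton, mul_comm]
    · rintro t ⟨ht, rfl⟩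
      obtain ⟨u, hu, h1, h2⟩ := key t ht
      rw [h1, Option.getD_some, Finset.mem_singleton]
      exact ⟨hu, by omega⟩
    · intro u hu hw
      rw [Finset.mem_singleton] at hw
      rw [← weightGF_insertions (p := p) (le_refl 0) hu.2 hu.1, coeff_weightGF]
      congr 2
      ext t
      constructor
      · rintro ⟨⟨ht, -⟩, h⟩
        obtain ⟨v, -, h1, -⟩ := key t ht
        rw [h1, Option.getD_some] at h
        exact ⟨⟨ht.1.1.2, h ▸ h1⟩, ht.1.2⟩
      · rintro ⟨⟨h1, h2⟩, h3⟩
        obtain ⟨-, a2, -, -, a5⟩ := eraseVar_eq_some h1 h2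
        refine ⟨⟨⟨⟨⟨(a5 0 le_rfl).2 hu.1, h1⟩, h3⟩, by simp [h2]⟩, by omega⟩, by simp [h2]⟩
  · rw [Nat.cast_eq_zero]
    convert Set.ncard_empty LambdaTerm
    ext t
    simp only [Set.mem_ofPred_eq, Set.mem_empty_iff_false, iff_false]
    rintro ⟨ht, rfl⟩
    obtain ⟨u, -, -, h⟩ := key t ht
    omega

/-- The factor `X` is the root abstraction; it turns the exponents `2k - 1` and `2k` into the `2k`
and `2k + 1` of the equation. -/
theorem X_mul_weightGF_bodies (p : ℕ) {k : ℕ} (hk : 1 ≤ k) :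
    X * weightGF (bodies p k) size = C (catalan (k - 1) : ℝ) * X ^ (2 * k) +
      deltaOp k (weightGF (closedBindsBetween p) size) := by
  have h : bodies p k = {t ∈ bodies p k | t.eraseVar 0 = none} ∪
      {t ∈ bodies p k | t.eraseVar 0 ≠ none} := by
    ext t
    simp only [Set.mem_union, Set.mem_ofPred_eq]
    tauto
  rw [h, weightGF_union ((finiteFibers_bodies p k).mono fun _ ht => ht.1)
    ((finiteFibers_bodies p k).mono fun _ ht => ht.1)
    (Set.disjoint_left.2 fun _ ht ht' => ht'.2 ht.2),
    weightGF_bodies_none p hk, weightGF_bodies_some, deltaOp_eq hk]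
  obtain ⟨k, rfl⟩ : ∃ j, k = j + 1 := ⟨k - 1, by omega⟩
  rw [show 2 * (k + 1) - 1 = 2 * k + 1 by omega]
  ring

theorem closedBindsBetween_eq (p : ℕ) :
    closedBindsBetween p =
      Set.image2 app (closedBindsBetween p) (closedBindsBetween p) ∪
        abs '' {t | (t.ClosedUnder 1 ∧ t.BindsBetween p) ∧ pointers 0 t ∈ Finset.Icc 1 p} := by
  ext t
  constructor
  · rintro ⟨h1, h2⟩
    cases t with
    | var k => exact absurd h1 (Nat.not_lt_zero k)
    | abs t => exact Or.inr ⟨t, ⟨⟨h1, h2.2⟩, Finset.mem_Icc.2 h2.1⟩, rfl⟩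
    | app s t => exact Or.inl ⟨s, ⟨h1.1, h2.1⟩, t, ⟨h1.2, h2.2⟩, rfl⟩
  · rintro (⟨s, hs, t, ht, rfl⟩ | ⟨t, ht, rfl⟩)
    · exact ⟨⟨hs.1, ht.1⟩, hs.2, ht.2⟩
    · exact ⟨ht.1.1, Finset.mem_Icc.1 ht.2, ht.1.2⟩

theorem bckEquation_weightGF (p : ℕ) : BCKEquation p (weightGF (closedBindsBetween p) size) := by
  have hfin := finiteFibers_closedBindsBetween p
  set Y := weightGF (closedBindsBetween p) size with hY
  set S : Set LambdaTerm :=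
    {t | (t.ClosedUnder 1 ∧ t.BindsBetween p) ∧ pointers 0 t ∈ Finset.Icc 1 p} with hS
  have hSfin : FiniteFibers S size := (finiteFibers_size 1).mono fun _ ht => ht.1.1
  have h1 : X * weightGF S size = ∑ k ∈ Finset.Icc 1 p,
      (C (catalan (k - 1) : ℝ) * X ^ (2 * k) + deltaOp k Y) := by
    rw [weightGF_eq_sum_fiberwise hSfin (Finset.Icc 1 p) (pointers 0) fun t ht => ht.2,
      Finset.mul_sum]
    refine Finset.sum_congr rfl fun k hk => ?_
    rw [← X_mul_weightGF_bodies p (Finset.mem_Icc.1 hk).1]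
    congr 2
    ext t
    constructor
    · rintro ⟨ht, h⟩
      exact ⟨ht.1, h⟩
    · rintro ⟨ht, h⟩
      exact ⟨⟨ht, h ▸ hk⟩, h⟩
  have h2 : Y = X * (Y * Y) + X * weightGF S size := by
    conv_lhs => rw [hY, closedBindsBetween_eq]
    rw [weightGF_union, weightGF_image2 app_injective2 (c := 1) hfin hfin,
      weightGF_image abs_injective (c := 1) (w := size), pow_one]
    · exact fun t _ => Nat.add_comm _ _
    · exact fun s t => by simp only [size]; omega
    · refine hfin.mono ?_
      conv_rhs => rw [closedBindsBetween_eq]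
      exact Set.subset_union_left
    · refine hfin.mono ?_
      conv_rhs => rw [closedBindsBetween_eq]
      exact Set.subset_union_right
    · rw [Set.disjoint_left]
      rintro _ ⟨s, _, t, _, rfl⟩ ⟨_, _, h⟩
      cases h
  rw [BCKEquation]
  conv_lhs => rw [h2, h1, Finset.sum_add_distrib]
  ring

theorem bckGF_eq_subst (p : ℕ) :
    bckGF p = (weightGF (closedBindsBetween p) size).subst (X * (1 - X)⁻¹ : ℝ⟦X⟧) := by
  have ha : HasSubst (X * (1 - X)⁻¹ : ℝ⟦X⟧) := HasSubst.of_constantCoeff_zero' (by simp)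
  ext n
  rw [coeff_subst' ha, finsum_eq_sum_of_support_subset (s := Finset.range (n + 1)), bckGF, coeff_mk,
    bckCount, ncard_eq_sum_coeff_weightGF_mul (BCK_finite p n) (finiteFibers_closedBindsBetween p)
    (Finset.range (n + 1)) prune fun d => coeff n ((X * (1 - X)⁻¹ : ℝ⟦X⟧) ^ d)]
  · rfl
  · rintro t ⟨ht, rfl⟩
    exact ⟨⟨closedUnder_prune.2 ht.1, bindsBetween_prune.2 ht.2⟩,
      Finset.mem_range.2 (Nat.lt_succ_of_le (size_prune_le t))⟩
  · intro u hu _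
    rw [← weightGF_paddings hu.2 hu.1, coeff_weightGF]
    congr 2
    ext t
    constructor
    · rintro ⟨⟨-, h1⟩, h2⟩
      exact ⟨h2, h1⟩
    · rintro ⟨rfl, h1⟩
      exact ⟨⟨⟨closedUnder_prune.1 hu.1, bindsBetween_prune.1 hu.2⟩, h1⟩, rfl⟩
  · intro d hd
    -- `(X/(1 - X))^d` is divisible by `X^d`, so only `d ≤ n` contributes to the `n`-th coefficient.
    rw [Finset.mem_coe, Finset.mem_range, Nat.lt_succ_iff]
    by_contra h
    refine hd ?_
    simp only [mul_pow, coeff_X_pow_mul', if_neg h, smul_zero]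

end LambdaTerm

theorem mainTheorem6 (p : ℕ) :
    ∃ Y : PowerSeries ℝ,
      ((∀ n : ℕ, 0 ≤ PowerSeries.coeff n Y) ∧ BCKEquation p Y) ∧
      (∀ Y' : PowerSeries ℝ,
        (∀ n : ℕ, 0 ≤ PowerSeries.coeff n Y') → BCKEquation p Y' → Y' = Y) ∧
      bckGF p = Y.subst (PowerSeries.X * (1 - PowerSeries.X)⁻¹ : PowerSeries ℝ) := by
  refine ⟨weightGF (LambdaTerm.closedBindsBetween p) LambdaTerm.size,
    ⟨fun n => ?_, LambdaTerm.bckEquation_weightGF p⟩,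
    fun Y' _ hY' => hY'.unique (LambdaTerm.bckEquation_weightGF p), LambdaTerm.bckGF_eq_subst p⟩
  rw [coeff_weightGF]
  exact Nat.cast_nonneg _
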